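/- Write $\langle\cdot,\cdot\rangle$ for the bilinear pairing of distributions with test functions, $\mathcal D'$ and $\mathcal S'$ for the spaces of (complex) distributions and of tempered distributions, and $C_0^\infty$ for the smooth functions of compact support. For $v\in C_0^\infty(\mathbb R^n)$ and $u\in\mathcal D'(\mathbb R^n)$ let $v\otimes u\in\mathcal D'(\mathbb R^n\times\mathbb R^n)$ be given by $\langle v\otimes u,\Phi\rangle=\langle u,\int v(x)\Phi(x,\cdot)\,dx\rangle$. *Extended pairing.* If $f,g\in\mathcal D'(\mathbb R^N)$ satisfy $\operatorname{sing\,supp} f\cap\operatorname{sing\,supp} g=\emptyset$, the product $fg\in\mathcal D'(\mathbb R^N)$ is the unique distribution such that $\langle fg,\varphi\rangle=\langle f,g\varphi\rangle$ for $\varphi\in C_0^\infty(\mathbb R^N\setminus\operatorname{sing\,supp} g)$ and $\langle fg,\varphi\rangle=\langle g,f\varphi\rangle$ for $\varphi\in C_0^\infty(\mathbb R^N\setminus\operatorname{sing\,supp} f)$. If moreover $\operatorname{supp} f\cap\operatorname{supp} g$ is compact, then $fg$ has compact support and one sets $\langle f,g\rangle:=\langle fg,1\rangle$, that is, $\langle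 f,g\rangle=\langle fg,\chi\rangle$ for every $\chi\in C_0^\infty(\mathbb R^N)$ equal to $1$ in a neighbourhood of $\operatorname{supp} fg$. **Theorem.** Let $A\colon\mathcal S'(\mathbb R^n)\to\mathcal S'(\mathbb R^n)$ be continuous and linear with distribution kernel $K\in\mathcal S'(\mathbb R^n\times\mathbb R^n)$, i.e. $\langle A\varphi,\psi\rangle=\langle K,\psi\otimes\varphi\rangle$ for all $\varphi,\psi\in C_0^\infty(\mathbb R^n)$. (i) Suppose that $u\in\mathcal S'(\mathbb R^n)$ and $v\in C_0^\infty(\mathbb R^n)$ satisfy $$\operatorname{supp}K\cap\operatorname{supp}(v\otimes u)\ \text{is compact},\qquad \operatorname{sing\,supp}K\cap\operatorname{sing\,supp}(v\otimes u)=\emptyset .$$ Then the extended pairing $\langle K,v\otimes u\rangle$ is defined and $\langle Au,v\rangle=\langle K,v\otimes u\rangle$. (ii) For every $u\in\mathcal S'(\mathbb R^n)$, $$\operatorname{supp}Au\subset\overline{\operatorname{supp}K\circ\operatorname{supp}u},\qquad \operatorname{supp}K\circ\operatorname{supp}u:=\{x\in\mathbb R^n\mid\exists\,y\in\operatorname{supp}u:\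 (x,y)\in\operatorname{supp}K\},$$ and $\operatorname{supp}K\circ\operatorname{supp}u$ is closed if $\operatorname{supp}u$ is compact. If instead $A\colon\mathcal D'(\mathbb R^n)\to\mathcal D'(\mathbb R^n)$ is continuous and linear with distribution kernel $K\in\mathcal D'(\mathbb R^n\times\mathbb R^n)$ (defined by the same identity), then (i) and (ii) hold with $\mathcal S'$ replaced by $\mathcal D'$ throughout. -/

import Mathlib

open Set TopologicalSpace MeasureTheory Distribution
open scoped Distributions SchwartzMap ContDiff Topology

noncomputable section

namespace DistKernel

/-! ### Test functions and distributions

`TestFn E` is `C_0^∞(E)` (complex valued, with its usual LF topology), and `Distr E` is its dual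
`D'(E)`. As for Mathlib's tempered distributions, the dual carries the topology of pointwise
convergence. -/

/-- The complex valued test functions `C_0^∞(E)`. -/
abbrev TestFn (E : Type) [NormedAddCommGroup E] [NormedSpace ℝ E] : Type :=
  𝓓((⊤ : Opens E), ℂ)

/-- The space `D'(E)` of complex distributions on `E`. -/
abbrev Distr (E : Type) [NormedAddCommGroup E] [NormedSpace ℝ E] : Type :=
  TestFn E →Lₚₜ[ℂ] ℂ

section General

variable {E F : Type} [NormedAddCommGroup E] [NormedSpace ℝ E]
  [NormedAddCommGroup F] [NormedSpace ℝ F]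

/-- The inclusion `C_0^∞(E) → 𝓢(E)`. -/
def toSchwartz (φ : TestFn E) : 𝓢(E, ℂ) :=
  φ.hasCompactSupport.toSchwartzMap φ.contDiff

@[simp] lemma toSchwartz_apply (φ : TestFn E) (x : E) : toSchwartz φ x = φ x := rfl

/-- The inclusion `C_0^∞(E) → 𝓢(E)` is continuous and linear. -/
def toSchwartzCLM : TestFn E →L[ℂ] 𝓢(E, ℂ) :=
  TestFunction.mkCLM ℂ toSchwartz (fun _ _ => rfl) (fun _ _ => rfl) <| by
    intro K hK
    let Φ : 𝓓^{⊤}_{K}(E, ℂ) →ₗ[ℂ] 𝓢(E, ℂ) :=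
      { toFun := toSchwartz ∘ TestFunction.ofSupportedIn hK
        map_add' := fun _ _ => rfl
        map_smul' := fun _ _ => rfl }
    change Continuous Φ
    refine WithSeminorms.continuous_of_isBounded
      (ContDiffMapSupportedIn.withSeminorms ℂ E ℂ ⊤ K) (schwartz_withSeminorms ℂ E ℂ) _
      (Seminorm.IsBounded.of_real fun i => ?_)
    obtain ⟨R, hR⟩ := K.isCompact.isBounded.exists_norm_le
    refine ⟨{i.2}, (max R 0) ^ i.1, fun f => ?_⟩
    simp only [Finset.sup_singleton]
    refine SchwartzMap.seminorm_le_bound ℂ i.1 i.2 _ (by positivity) fun x => ?_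
    change ‖x‖ ^ i.1 * ‖iteratedFDeriv ℝ i.2 f x‖ ≤ _
    by_cases hx : x ∈ K
    · have h1 : ‖x‖ ≤ max R 0 := (hR x hx).trans (le_max_left _ _)
      have h2 := ContDiffMapSupportedIn.norm_iteratedFDeriv_apply_le_seminorm_top ℂ
        (i := i.2) (f := f) (x := x)
      refine mul_le_mul (pow_le_pow_left₀ (norm_nonneg x) h1 _) h2 (norm_nonneg _) (by positivity)
    · have h0 : iteratedFDeriv ℝ i.2 f x = 0 := f.iteratedFDeriv_zero_on_compl hx
      rw [h0, norm_zero, mul_zero]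
      positivity

/-- The inclusion `𝓢'(E) → D'(E)`: restriction of a tempered distribution to `C_0^∞(E)`. -/
def toDistr (u : 𝓢'(E, ℂ)) : Distr E :=
  PointwiseConvergenceCLM.precomp ℂ toSchwartzCLM u

@[simp] lemma toDistr_apply (u : 𝓢'(E, ℂ)) (φ : TestFn E) :
    toDistr u φ = u (toSchwartz φ) := rfl

/-- The product `φ ⊗ ψ` of two test functions: `(φ ⊗ ψ)(x, y) = φ(x) ψ(y)`. -/
def tensorTest (φ : TestFn E) (ψ : TestFn F) : TestFn (E × F) where
  toFun p := φ p.1 * ψ p.2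
  contDiff' := (φ.contDiff.comp contDiff_fst).mul (ψ.contDiff.comp contDiff_snd)
  hasCompactSupport' := by
    refine HasCompactSupport.of_support_subset_isCompact
      (φ.hasCompactSupport.isCompact.prod ψ.hasCompactSupport.isCompact) ?_
    intro p hp
    have hp' : φ p.1 * ψ p.2 ≠ 0 := hp
    exact ⟨subset_tsupport _ (left_ne_zero_of_mul hp'),
      subset_tsupport _ (right_ne_zero_of_mul hp')⟩
  tsupport_subset' := fun _ _ => trivial

@[simp] lemma tensorTest_apply (φ : TestFn E) (ψ : TestFn F) (p : E × F) :
    tensorTest φ ψ p = φ p.1 * ψ p.2 := rfl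

/-- The product `g φ` of a test function `φ` with a function `g` that is smooth on an open set
`U` containing the support of `φ`. -/
def mulOn (U : Opens E) (g : E → ℂ) (hg : ContDiffOn ℝ ∞ g U) (φ : TestFn E)
    (hφ : tsupport φ ⊆ U) : TestFn E where
  toFun x := g x * φ x
  contDiff' := by
    refine contDiff_iff_contDiffAt.2 fun x => ?_
    by_cases hx : x ∈ tsupport φ
    · exact (hg.contDiffAt (U.isOpen.mem_nhds (hφ hx))).mul φ.contDiff.contDiffAt
    · refine contDiffAt_const (c := (0 : ℂ)) |>.congr_of_eventuallyEq ?_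
      filter_upwards [(isClosed_tsupport φ).isOpen_compl.mem_nhds hx] with y hy
      rw [image_eq_zero_of_notMem_tsupport hy, mul_zero]
  hasCompactSupport' := φ.hasCompactSupport.mul_left
  tsupport_subset' := fun _ _ => trivial

@[simp] lemma mulOn_apply (U : Opens E) (g : E → ℂ) (hg : ContDiffOn ℝ ∞ g U) (φ : TestFn E)
    (hφ : tsupport φ ⊆ U) (x : E) : mulOn U g hg φ hφ x = g x * φ x := rfl

/-- Multiplication of test functions by a smooth function, as a continuous linear map. -/
def mulCLM (g : E → ℂ) (hg : ContDiff ℝ ∞ g) : TestFn E →L[ℂ] TestFn E :=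
  TestFunction.limitCLM ℂ
    (fun φ => mulOn ⊤ g hg.contDiffOn φ (fun _ _ => trivial))
    (fun _ hK => TestFunction.ofSupportedInCLM ℂ hK ∘L
      ContDiffMapSupportedIn.bilinLeftCLM (ContinuousLinearMap.mul ℂ ℂ) hg)
    (fun _ _ f => by
      ext x
      exact mul_comm (g x) (f x))

@[simp] lemma mulCLM_apply (g : E → ℂ) (hg : ContDiff ℝ ∞ g) (φ : TestFn E) (x : E) :
    mulCLM g hg φ x = g x * φ x := rfl

end General

section PartialIntegral

variable {E F : Type} [NormedAddCommGroup E] [NormedSpace ℝ E] [FiniteDimensional ℝ E]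
  [MeasureSpace E] [BorelSpace E] [(volume : Measure E).IsAddHaarMeasure]
  [NormedAddCommGroup F] [NormedSpace ℝ F]

/-- Differentiation under the integral sign, first order. -/
lemma hasFDerivAt_partialInt {G : Type} [NormedAddCommGroup G] [NormedSpace ℝ G]
    {f : E × F → G} (hf : ContDiff ℝ ∞ f) (hc : HasCompactSupport f) (y : F) :
    HasFDerivAt (fun y => ∫ x : E, f (x, y))
      (∫ x : E, (fderiv ℝ f (x, y)).comp (ContinuousLinearMap.inr ℝ E F)) y := by
  have hslice : ∀ y : F, HasCompactSupport fun x : E => f (x, y) := fun y =>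
    HasCompactSupport.of_support_subset_isCompact (hc.isCompact.image continuous_fst)
      fun x hx => ⟨(x, y), subset_tsupport _ hx, rfl⟩
  have hf' : Continuous (fderiv ℝ f) := hf.continuous_fderiv (by simp)
  have hc' : HasCompactSupport (fderiv ℝ f) := hc.fderiv ℝ
  obtain ⟨C, hC⟩ := hf'.bounded_above_of_compact_support hc'
  set S : Set E := Prod.fst '' tsupport (fderiv ℝ f) with hS
  have hSc : IsCompact S := hc'.isCompact.image continuous_fst
  have : ProperSpace E := FiniteDimensional.proper_real E
  have : SecondCountableTopology E := secondCountable_of_proper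
  have : SecondCountableTopologyEither E (F →L[ℝ] G) := ⟨Or.inl inferInstance⟩
  have : SecondCountableTopologyEither E G := ⟨Or.inl inferInstance⟩
  refine hasFDerivAt_integral_of_dominated_of_fderiv_le (𝕜 := ℝ) (μ := (volume : Measure E))
    (F := fun y x => f (x, y)) (s := univ)
    (F' := fun y x => (fderiv ℝ f (x, y)).comp (ContinuousLinearMap.inr ℝ E F))
    (bound := S.indicator fun _ => C * ‖ContinuousLinearMap.inr ℝ E F‖) Filter.univ_mem
    (Filter.Eventually.of_forall fun y => ?_) ?_ ?_
    (Filter.Eventually.of_forall fun x y _ => ?_) ?_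
    (Filter.Eventually.of_forall fun x y _ => ?_)
  · exact (hf.continuous.comp (by fun_prop : Continuous fun x : E => (x, y))).aestronglyMeasurable
  · exact (hf.continuous.comp (by fun_prop : Continuous fun x : E => (x, y))).integrable_of_hasCompactSupport
      (hslice y)
  · refine Continuous.aestronglyMeasurable ?_
    exact (hf'.comp (by fun_prop : Continuous fun x : E => (x, y))).clm_comp continuous_const
  · by_cases hx : x ∈ S
    · rw [indicator_of_mem hx]
      refine (ContinuousLinearMap.opNorm_comp_le _ _).trans ?_
      gcongr
      exact hC _
    · rw [indicator_of_notMem hx]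
      have : fderiv ℝ f (x, y) = 0 := by
        by_contra h
        exact hx ⟨(x, y), subset_tsupport _ h, rfl⟩
      simp [this]
  · refine (integrable_indicator_iff hSc.measurableSet).2 ?_
    exact integrableOn_const hSc.measure_lt_top.ne
  · have h1 : HasFDerivAt f (fderiv ℝ f (x, y)) (x, y) :=
      ((hf.differentiable (by simp)) (x, y)).hasFDerivAt
    exact h1.comp y (hasFDerivAt_prodMk_right x y)

/-- Differentiation under the integral sign, all orders, with bounds. -/
lemma partialInt_aux (S : Set E) (hS : IsCompact S) (k : ℕ) :
    ∀ {G : Type} [NormedAddCommGroup G] [NormedSpace ℝ G]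
    {f : E × F → G} (_ : ContDiff ℝ ∞ f) (_ : HasCompactSupport f)
    (_ : Function.support f ⊆ S ×ˢ univ),
    ContDiff ℝ k (fun y => ∫ x : E, f (x, y)) ∧
    ∀ M : ℝ, (∀ p, ‖iteratedFDeriv ℝ k f p‖ ≤ M) → ∀ y,
      ‖iteratedFDeriv ℝ k (fun y => ∫ x : E, f (x, y)) y‖ ≤ M * volume.real S := by
  induction k with
  | zero =>
    intro G _ _ f hf hc hs
    have hd : Differentiable ℝ (fun y => ∫ x : E, f (x, y)) := fun y =>
      (hasFDerivAt_partialInt hf hc y).differentiableAt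
    refine ⟨by exact_mod_cast (contDiff_zero (𝕜 := ℝ)).2 hd.continuous, fun M hM y => ?_⟩
    rw [norm_iteratedFDeriv_zero]
    have : ∫ x : E, f (x, y) = ∫ x in S, f (x, y) := by
      refine (setIntegral_eq_integral_of_forall_compl_eq_zero fun x hx => ?_).symm
      by_contra h
      exact hx (hs (show (x, y) ∈ Function.support f from h)).1
    rw [this]
    refine norm_setIntegral_le_of_norm_le_const hS.measure_lt_top fun x _ => ?_
    simpa using hM (x, y)
  | succ k ih =>
    intro G _ _ f hf hc hs
    set L : (E × F →L[ℝ] G) →L[ℝ] (F →L[ℝ] G) :=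
      ((ContinuousLinearMap.compL ℝ F (E × F) G).flip (ContinuousLinearMap.inr ℝ E F)) with hL
    have hL1 : ‖L‖ ≤ 1 := by
      refine ContinuousLinearMap.opNorm_le_bound _ zero_le_one fun T => ?_
      rw [one_mul]
      refine ContinuousLinearMap.opNorm_le_bound _ (norm_nonneg _) fun y => ?_
      refine (T.le_opNorm _).trans ?_
      gcongr
      simp [Prod.norm_def]
    set f' : E × F → (F →L[ℝ] G) := fun p => L (fderiv ℝ f p) with hf'def
    have hfd : ContDiff ℝ ∞ (fderiv ℝ f) := hf.fderiv_right (by simp)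
    have hf' : ContDiff ℝ ∞ f' := L.contDiff.comp hfd
    have hc' : HasCompactSupport f' := (hc.fderiv ℝ).comp_left (map_zero L)
    have hs' : Function.support f' ⊆ S ×ˢ univ := by
      intro p hp
      have h1 : p ∈ Function.support (fderiv ℝ f) := by
        intro h
        exact hp (by simp [hf'def, h])
      have h2 : tsupport f ⊆ S ×ˢ univ :=
        closure_minimal hs (hS.isClosed.prod isClosed_univ)
      exact h2 (support_fderiv_subset ℝ h1)
    obtain ⟨ih1, ih2⟩ := ih hf' hc' hs'
    have hder : ∀ y, HasFDerivAt (fun y => ∫ x : E, f (x, y)) (∫ x : E, f' (x, y)) y :=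
      hasFDerivAt_partialInt hf hc
    have hfder : fderiv ℝ (fun y => ∫ x : E, f (x, y)) = fun y => ∫ x : E, f' (x, y) :=
      funext fun y => (hder y).fderiv
    refine ⟨?_, fun M hM y => ?_⟩
    · have := (contDiff_succ_iff_fderiv (𝕜 := ℝ) (n := (k : WithTop ℕ∞))
        (f := fun y => ∫ x : E, f (x, y))).2
        ⟨fun y => (hder y).differentiableAt, by simp, by rw [hfder]; exact ih1⟩
      exact_mod_cast this
    · rw [← norm_iteratedFDeriv_fderiv, hfder]
      refine ih2 M (fun p => ?_) y
      have h1 : iteratedFDeriv ℝ k f' p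
          = L.compContinuousMultilinearMap (iteratedFDeriv ℝ k (fderiv ℝ f) p) :=
        L.iteratedFDeriv_comp_left hfd.contDiffAt (by exact_mod_cast le_top)
      rw [h1]
      refine (L.norm_compContinuousMultilinearMap_le _).trans ?_
      rw [norm_iteratedFDeriv_fderiv]
      calc ‖L‖ * ‖iteratedFDeriv ℝ (k + 1) f p‖ ≤ 1 * M := by
            gcongr
            exact hM p
        _ = M := one_mul M

lemma slice_integrable (f : TestFn (E × F)) (y : F) : Integrable fun x : E => f (x, y) :=
  (f.continuous.comp (by fun_prop : Continuous fun x : E => (x, y))).integrable_of_hasCompactSupport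
    (HasCompactSupport.of_support_subset_isCompact
      (f.hasCompactSupport.isCompact.image continuous_fst)
      fun x hx => ⟨(x, y), subset_tsupport _ hx, rfl⟩)

/-- Partial integration of a test function: `(partialInt Φ)(y) = ∫ Φ(x, y) dx`. -/
def partialInt (f : TestFn (E × F)) : TestFn F where
  toFun y := ∫ x : E, f (x, y)
  contDiff' := by
    refine contDiff_infty.2 fun k => (partialInt_aux (Prod.fst '' tsupport f)
      (f.hasCompactSupport.isCompact.image continuous_fst) k f.contDiff f.hasCompactSupport ?_).1
    exact fun p hp => ⟨⟨p, subset_tsupport _ hp, rfl⟩, trivial⟩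
  hasCompactSupport' := by
    refine HasCompactSupport.of_support_subset_isCompact
      (f.hasCompactSupport.isCompact.image continuous_snd) fun y hy => ?_
    by_contra h
    refine hy (integral_eq_zero_of_ae (Filter.Eventually.of_forall fun x => ?_))
    by_contra hx
    exact h ⟨(x, y), subset_tsupport _ hx, rfl⟩
  tsupport_subset' := fun _ _ => trivial

@[simp] lemma partialInt_apply (f : TestFn (E × F)) (y : F) :
    partialInt f y = ∫ x : E, f (x, y) := rfl

/-- Partial integration is continuous and linear. -/
def partialIntCLM : TestFn (E × F) →L[ℂ] TestFn F :=
  TestFunction.mkCLM ℂ partialInt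
    (fun f g => by
      ext y
      exact integral_add (slice_integrable f y) (slice_integrable g y))
    (fun c f => by
      ext y
      exact integral_smul c fun x : E => f (x, y)) <| by
    intro K hK
    let S : Set E := Prod.fst '' (K : Set (E × F))
    have hS : IsCompact S := K.isCompact.image continuous_fst
    let K' : Compacts F := ⟨Prod.snd '' (K : Set (E × F)), K.isCompact.image continuous_snd⟩
    have hint : ∀ (f : 𝓓^{⊤}_{K}(E × F, ℂ)) (y : F), Integrable fun x : E => f (x, y) :=
      fun f y => slice_integrable (TestFunction.ofSupportedIn hK f) y
    let T : 𝓓^{⊤}_{K}(E × F, ℂ) →ₗ[ℂ] 𝓓^{⊤}_{K'}(F, ℂ) :=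
      { toFun := fun f => ⟨fun y => ∫ x : E, f (x, y),
          (partialInt (TestFunction.ofSupportedIn hK f)).contDiff, fun y hy => by
            refine integral_eq_zero_of_ae (Filter.Eventually.of_forall fun x => ?_)
            exact f.zero_on_compl fun h => hy ⟨(x, y), h, rfl⟩⟩
        map_add' := fun f g => by
          ext y
          exact integral_add (hint f y) (hint g y)
        map_smul' := fun c f => by
          ext y
          exact integral_smul c fun x : E => f (x, y) }
    have hT : Continuous T := by
      refine WithSeminorms.continuous_of_isBounded
        (ContDiffMapSupportedIn.withSeminorms ℂ (E × F) ℂ ⊤ K)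
        (ContDiffMapSupportedIn.withSeminorms ℂ F ℂ ⊤ K') _
        (Seminorm.IsBounded.of_real fun i => ⟨{i}, volume.real S, fun f => ?_⟩)
      simp only [Finset.sup_singleton]
      refine (ContDiffMapSupportedIn.seminorm_top_le_iff ℂ
        (mul_nonneg measureReal_nonneg (apply_nonneg _ _)) i (T f)).2 fun y _ => ?_
      change ‖iteratedFDeriv ℝ i (fun y => ∫ x : E, f (x, y)) y‖ ≤ volume.real S * _
      rw [mul_comm]
      exact (partialInt_aux S hS i f.contDiff f.hasCompactSupport
        (fun p hp => ⟨⟨p, f.support_subset hp, rfl⟩, trivial⟩)).2 _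
        (fun p => ContDiffMapSupportedIn.norm_iteratedFDeriv_apply_le_seminorm_top ℂ) y
    have : (partialInt ∘ TestFunction.ofSupportedIn hK : 𝓓^{⊤}_{K}(E × F, ℂ) → TestFn F)
        = TestFunction.ofSupportedIn (subset_univ _) ∘ T := rfl
    rw [this]
    exact (TestFunction.continuous_ofSupportedIn _).comp hT

/-- The tensor product `v ⊗ u ∈ D'(E × F)` of a test function `v` on `E` and a distribution
`u` on `F`: `⟨v ⊗ u, Φ⟩ = ⟨u, y ↦ ∫ v(x) Φ(x, y) dx⟩`. -/
def tensorDist (v : TestFn E) (u : Distr F) : Distr (E × F) :=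
  PointwiseConvergenceCLM.precomp ℂ
    (partialIntCLM ∘L mulCLM (fun p : E × F => v p.1) (v.contDiff.comp contDiff_fst)) u

lemma tensorDist_apply (v : TestFn E) (u : Distr F) (Φ : TestFn (E × F)) :
    tensorDist v u Φ =
      u (partialInt (mulCLM (fun p : E × F => v p.1) (v.contDiff.comp contDiff_fst) Φ)) := rfl

end PartialIntegral

section Singular

variable {E : Type} [NormedAddCommGroup E] [NormedSpace ℝ E] [MeasureSpace E]

/-- On the open set `U` the distribution `f` is the smooth function `g`. -/
def IsSmoothFunOn (f : Distr E) (U : Opens E) (g : E → ℂ) : Prop :=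
  ContDiffOn ℝ ∞ g U ∧ ∀ φ : TestFn E, tsupport φ ⊆ U → f φ = ∫ x, g x * φ x

/-- The singular support: the complement of the largest open set on which `f` is a smooth
function. -/
def singSupport (f : Distr E) : Set E :=
  {x | ¬ ∃ (U : Opens E) (g : E → ℂ), x ∈ U ∧ IsSmoothFunOn f U g}

/-- `P` is the product `f u`: on every open set where `f` is a smooth function `g`, `P` is the
usual product `g u`, that is `⟨P, φ⟩ = ⟨u, g φ⟩`; and likewise with `f` and `u` interchanged.
When the singular supports of `f` and `u` are disjoint, such open sets cover the space, so that
this determines `P`. -/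
def IsProduct (f u P : Distr E) : Prop :=
  (∀ (U : Opens E) (g : E → ℂ) (hg : IsSmoothFunOn f U g) (φ : TestFn E) (hφ : tsupport φ ⊆ U),
    P φ = u (mulOn U g hg.1 φ hφ)) ∧
  (∀ (U : Opens E) (g : E → ℂ) (hg : IsSmoothFunOn u U g) (φ : TestFn E) (hφ : tsupport φ ⊆ U),
    P φ = f (mulOn U g hg.1 φ hφ))

/-- The extended pairing `⟨f, u⟩` of two distributions is defined and has the value `c`: the
product `f u` exists, is unique and has compact support, and `⟨f u, 1⟩ = c`, where
`⟨f u, 1⟩ = ⟨f u, χ⟩` for every test function `χ` that equals `1` around the support of `f u`. -/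
def HasExtPairing (f u : Distr E) (c : ℂ) : Prop :=
  ∃ P : Distr E, IsProduct f u P ∧ (∀ Q : Distr E, IsProduct f u Q → Q = P) ∧
    IsCompact (dsupport P) ∧
    ∀ χ : TestFn E, (∀ᶠ x in 𝓝ˢ (dsupport P), χ x = 1) → P χ = c

/-- The value of the extended pairing is unique. -/
lemma HasExtPairing.unique [FiniteDimensional ℝ E] {f u : Distr E} {c c' : ℂ}
    (h : HasExtPairing f u c) (h' : HasExtPairing f u c') : c = c' := by
  obtain ⟨P, hP, -, hK, h1⟩ := h
  obtain ⟨P', -, hQ, -, h1'⟩ := h'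
  obtain rfl := hQ P hP
  obtain ⟨χ, hχ⟩ : ∃ χ : TestFn E, ∀ᶠ x in 𝓝ˢ (dsupport P), χ x = 1 := by
    obtain ⟨R, hR⟩ := hK.isBounded.subset_ball (0 : E)
    obtain ⟨f, hf0, hf1, -⟩ := exists_contMDiffMap_zero_one_nhds_of_isClosed (n := ⊤)
      (modelWithCornersSelf ℝ E) (Metric.isOpen_ball (x := (0 : E)) (ε := R)).isClosed_compl
      hK.isClosed (disjoint_compl_left_iff_subset.2 hR)
    have hf : ContDiff ℝ ∞ f := contMDiff_iff_contDiff.1 f.contMDiff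
    have hs : Function.support f ⊆ Metric.closedBall (0 : E) R := by
      intro x hx
      by_contra h
      exact hx (hf0.self_of_nhdsSet x fun h' => h (Metric.ball_subset_closedBall h'))
    refine ⟨⟨fun x => (f x : ℂ), Complex.ofRealCLM.contDiff.comp hf,
      HasCompactSupport.of_support_subset_isCompact (isCompact_closedBall (0 : E) R) ?_,
      fun _ _ => trivial⟩, ?_⟩
    · intro x hx
      exact hs fun h => hx (by simp [h])
    · filter_upwards [hf1] with x hx
      change (f x : ℂ) = 1
      simp [hx]
  rw [← h1 χ hχ, ← h1' χ hχ]

end Singular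

section Kernels

variable {E : Type} [NormedAddCommGroup E] [NormedSpace ℝ E] [FiniteDimensional ℝ E]
  [MeasureSpace E] [BorelSpace E] [(volume : Measure E).IsAddHaarMeasure]

/-- A test function `φ` as a distribution, `⟨φ, ψ⟩ = ∫ φ ψ`. -/
def ofTest (φ : TestFn E) : Distr E :=
  show TestFn E →L[ℂ] ℂ from
    TestFunction.integralAgainstBilinCLM (ContinuousLinearMap.mul ℂ ℂ) volume φ

lemma ofTest_apply (φ ψ : TestFn E) : ofTest φ ψ = ∫ x, ψ x * φ x :=
  TestFunction.integralAgainstBilinCLM_eq_integral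
    ((φ.continuous.locallyIntegrable).locallyIntegrableOn _)

/-- `K ∈ D'(E × E)` is the distribution kernel of `A : D'(E) → D'(E)`:
`⟨A φ, ψ⟩ = ⟨K, ψ ⊗ φ⟩` for all test functions `φ`, `ψ`. -/
def IsKernel (A : Distr E →L[ℂ] Distr E) (K : Distr (E × E)) : Prop :=
  ∀ φ ψ : TestFn E, A (ofTest φ) ψ = K (tensorTest ψ φ)

/-- `K ∈ 𝓢'(E × E)` is the distribution kernel of `A : 𝓢'(E) → 𝓢'(E)`:
`⟨A φ, ψ⟩ = ⟨K, ψ ⊗ φ⟩` for all test functions `φ`, `ψ` (by density of `C_0^∞` in `𝓢` the same then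
holds for Schwartz functions). -/
def IsTemperedKernel (A : 𝓢'(E, ℂ) →L[ℂ] 𝓢'(E, ℂ)) (K : 𝓢'(E × E, ℂ)) : Prop :=
  ∀ φ ψ : TestFn E,
    A (SchwartzMap.toTemperedDistributionCLM E ℂ volume (toSchwartz φ)) (toSchwartz ψ)
      = K (toSchwartz (tensorTest ψ φ))

end Kernels

/-- The composition `S ∘ T = {x | ∃ y ∈ T, (x, y) ∈ S}` of a relation `S` and a set `T`. -/
def relComp {X Y : Type} (S : Set (X × Y)) (T : Set Y) : Set X :=
  {x | ∃ y ∈ T, (x, y) ∈ S}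

/-- Euclidean space `ℝⁿ`. -/
abbrev Rn (n : ℕ) : Type := EuclideanSpace ℝ (Fin n)

end DistKernel

end

open DistKernel

/-! Everything rests on transposition. The duals carry the topology of pointwise convergence, so for
fixed `v` the functional `u ↦ ⟨Au, v⟩` is evaluation at some `w` (`exists_eq_eval_of_pointwise`), a
test function for `D'` and a Schwartz function for `𝓢'`. Taking for `u` a test function `φ` in the
kernel identity gives `⟨K, v ⊗ φ⟩ = ∫ w φ`: applied to `v` in the first variable, `K` is the smooth
function `w`. Hence `w` lives on the points `y` with `(x, y) ∈ supp K` for some `x ∈ supp v`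
(`tsupport_subset_of_kernel`).

For (ii), if `supp v` misses the closure of `supp K ∘ supp u`, then `supp w` misses `supp u`, so
`⟨Au, v⟩ = ⟨u, w⟩ = 0`. In the tempered case `w` need not have compact support, and this vanishing
uses approximation by cutoffs (`tempered_apply_eq_zero_of_disjoint`).

For (i), the product `P = K (v ⊗ u)` is glued by a partition of unity (`exists_isProduct`), and its
pairing with `1` is computed on `θ ⊗ χ`, with `θ = 1` near `supp v` and `χ = 1` near the projection
of the compact intersection of supports. Over each `y`, either `u` is smooth near `y` or `K` is
smooth near `supp v × {y}`, because `supp v × sing supp u ⊆ sing supp (v ⊗ u)`. Splitting `χ`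
accordingly, Fubini and the kernel identity turn both pieces into `⟨u, w χᵢ⟩`; the sum is `⟨u, w χ⟩
= ⟨u, w⟩` (`hasExtPairing_tensorDist`). -/

noncomputable section

namespace DistKernel

/-! ### Cutoffs, partitions of unity and localization. -/

section Localization

variable {E : Type} [NormedAddCommGroup E] [NormedSpace ℝ E]

@[simp] lemma testFn_add_apply (φ ψ : TestFn E) (x : E) : (φ + ψ) x = φ x + ψ x := rfl

lemma tsupport_mulCLM_subset_right (g : E → ℂ) (hg : ContDiff ℝ ∞ g) (φ : TestFn E) :
    tsupport (mulCLM g hg φ) ⊆ tsupport φ :=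
  closure_mono (Function.support_mul_subset_right g φ)

lemma tsupport_mulCLM_subset_left (g : E → ℂ) (hg : ContDiff ℝ ∞ g) (φ : TestFn E) :
    tsupport (mulCLM g hg φ) ⊆ tsupport g :=
  closure_mono (Function.support_mul_subset_left g φ)

/-- A product of a function that is smooth on an open set with a smooth function supported in that
set is smooth. -/
lemma contDiff_mul_of_tsupport_subset {U : Set E} (hU : IsOpen U) {g ρ : E → ℂ}
    (hg : ContDiffOn ℝ ∞ g U) (hρ : ContDiff ℝ ∞ ρ) (h : tsupport ρ ⊆ U) :
    ContDiff ℝ ∞ fun x => g x * ρ x := by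
  refine contDiff_iff_contDiffAt.2 fun x => ?_
  by_cases hx : x ∈ tsupport ρ
  · exact (hg.contDiffAt (hU.mem_nhds (h hx))).mul hρ.contDiffAt
  · refine contDiffAt_const (c := (0 : ℂ)) |>.congr_of_eventuallyEq ?_
    filter_upwards [(isClosed_tsupport ρ).isOpen_compl.mem_nhds hx] with y hy
    rw [image_eq_zero_of_notMem_tsupport hy, mul_zero]

/-- A smooth partition of unity for a cover by two open sets. -/
lemma exists_smooth_partition [FiniteDimensional ℝ E] {U V : Set E} (hU : IsOpen U)
    (hV : IsOpen V) (h : U ∪ V = univ) :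
    ∃ ρ σ : E → ℂ, ContDiff ℝ ∞ ρ ∧ ContDiff ℝ ∞ σ ∧ (∀ x, ρ x + σ x = 1) ∧
      tsupport ρ ⊆ U ∧ tsupport σ ⊆ V := by
  -- `f` is `0` near `Uᶜ` and `1` near `Vᶜ`; vanishing on neighbourhoods is what puts the closed
  -- supports of `f` and `1 - f` inside `U` and `V`.
  obtain ⟨f, hf0, hf1, -⟩ := exists_contMDiffMap_zero_one_nhds_of_isClosed (n := ⊤)
    (modelWithCornersSelf ℝ E) hU.isClosed_compl hV.isClosed_compl
    (disjoint_compl_left_iff_subset.2 (compl_subset_iff_union.2 (by rwa [union_comm])))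
  have hf : ContDiff ℝ ∞ fun x => (f x : ℂ) :=
    Complex.ofRealCLM.contDiff.comp (contMDiff_iff_contDiff.1 f.contMDiff)
  refine ⟨fun x => (f x : ℂ), fun x => 1 - (f x : ℂ), hf, contDiff_const.sub hf,
    fun x => by ring, ?_, ?_⟩
  · intro x hx
    by_contra hxU
    refine (notMem_tsupport_iff_eventuallyEq.2 ?_) hx
    filter_upwards [mem_nhdsSet_iff_forall.1 hf0 x hxU] with y hy
    have : f y = 0 := hy
    simp [this]
  · intro x hx
    by_contra hxV
    refine (notMem_tsupport_iff_eventuallyEq.2 ?_) hx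
    filter_upwards [mem_nhdsSet_iff_forall.1 hf1 x hxV] with y hy
    have : f y = 1 := hy
    simp [this]

/-- A test function equal to `1` around a given compact set, supported in a given neighbourhood. -/
lemma exists_testFn_one_nhds [FiniteDimensional ℝ E] {C U : Set E} (hC : IsCompact C)
    (hU : IsOpen U) (h : C ⊆ U) :
    ∃ χ : TestFn E, (∀ᶠ x in 𝓝ˢ C, χ x = 1) ∧ tsupport χ ⊆ U := by
  have : ProperSpace E := FiniteDimensional.proper_real E
  obtain ⟨L, hL, hCL, hLU⟩ := exists_compact_between hC hU h
  obtain ⟨ρ, σ, hρ, -, hsum, hρL, hσ⟩ := exists_smooth_partition isOpen_interior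
    hC.isClosed.isOpen_compl (eq_univ_of_forall fun x => (em (x ∈ C)).imp (@hCL x) id)
  have hρL' := hρL.trans interior_subset
  refine ⟨⟨ρ, hρ, hL.of_isClosed_subset (isClosed_tsupport ρ) hρL', fun _ _ => trivial⟩, ?_,
    hρL'.trans hLU⟩
  refine Filter.mem_of_superset ((isClosed_tsupport σ).isOpen_compl.mem_nhdsSet.2
    (subset_compl_comm.1 hσ)) fun x hx => ?_
  have := hsum x
  rwa [image_eq_zero_of_notMem_tsupport hx, add_zero] at this

/-- A test function supported in the union of two open sets splits accordingly. -/
lemma exists_testFn_split [FiniteDimensional ℝ E] {U V : Set E} (hU : IsOpen U) (hV : IsOpen V)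
    (φ : TestFn E) (h : tsupport φ ⊆ U ∪ V) :
    ∃ φ₁ φ₂ : TestFn E, φ = φ₁ + φ₂ ∧ tsupport φ₁ ⊆ tsupport φ ∩ U ∧
      tsupport φ₂ ⊆ tsupport φ ∩ V := by
  have hc : IsOpen (tsupport φ)ᶜ := (isClosed_tsupport φ).isOpen_compl
  -- Enlarging `U` by the complement of `tsupport φ` gives a cover of the whole space, and is
  -- harmless after multiplication by `φ`.
  obtain ⟨ρ, σ, hρ, hσ, hsum, hρU, hσV⟩ := exists_smooth_partition (hU.union hc) hV (by
    refine eq_univ_of_forall fun x => ?_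
    by_cases hx : x ∈ tsupport φ
    · rcases h hx with h | h
      · exact Or.inl (Or.inl h)
      · exact Or.inr h
    · exact Or.inl (Or.inr hx))
  refine ⟨mulCLM ρ hρ φ, mulCLM σ hσ φ, ?_, fun x hx => ?_, fun x hx => ?_⟩
  · ext x
    simp [← add_mul, hsum]
  · have h1 := tsupport_mulCLM_subset_right _ hρ _ hx
    exact ⟨h1, (hρU (tsupport_mulCLM_subset_left _ hρ _ hx)).resolve_right fun h => h h1⟩
  · exact ⟨tsupport_mulCLM_subset_right _ hσ _ hx, hσV (tsupport_mulCLM_subset_left _ hσ _ hx)⟩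

/-- A property of test functions that is additive and holds locally near the support of `φ` holds
for `φ`. -/
lemma testFn_induction_local [FiniteDimensional ℝ E] {p : TestFn E → Prop} (h0 : p 0)
    (hadd : ∀ f g, p f → p g → p (f + g)) (φ : TestFn E)
    (hloc : ∀ x ∈ tsupport φ, ∃ V : Set E, IsOpen V ∧ x ∈ V ∧
      ∀ ψ : TestFn E, tsupport ψ ⊆ tsupport φ → tsupport ψ ⊆ V → p ψ) : p φ := by
  choose! V hVo hxV hV using hloc
  obtain ⟨t, ht, htφ⟩ := φ.hasCompactSupport.isCompact.elim_nhds_subcover V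
    fun x hx => (hVo x hx).mem_nhds (hxV x hx)
  suffices ∀ s : Finset E, (∀ x ∈ s, x ∈ tsupport φ) → ∀ ψ : TestFn E, tsupport ψ ⊆ tsupport φ →
      tsupport ψ ⊆ ⋃ x ∈ s, V x → p ψ from this t ht φ Subset.rfl htφ
  classical
  intro s
  induction s using Finset.induction_on with
  | empty =>
    intro _ ψ _ hψ
    have : ψ = 0 := by
      ext x
      exact image_eq_zero_of_notMem_tsupport fun h => by simpa using hψ h
    rwa [this]
  | insert a s _ ih =>
    intro hs ψ hψ hψs
    rw [Finset.set_biUnion_insert] at hψs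
    obtain ⟨ψ₁, ψ₂, rfl, h1, h2⟩ := exists_testFn_split (hVo a (hs a (by simp)))
      (isOpen_biUnion fun x hx => hVo x (hs x (Finset.mem_insert_of_mem hx))) ψ hψs
    refine hadd _ _ (hV a (hs a (by simp)) _ ((h1.trans inter_subset_left).trans hψ)
      (h1.trans inter_subset_right)) ?_
    exact ih (fun x hx => hs x (Finset.mem_insert_of_mem hx)) _
      ((h2.trans inter_subset_left).trans hψ) (h2.trans inter_subset_right)

/-- A distribution vanishes on test functions supported off its support. -/
lemma apply_eq_zero_of_disjoint_dsupport [FiniteDimensional ℝ E] (f : Distr E) (φ : TestFn E)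
    (h : Disjoint (tsupport φ) (dsupport f)) : f φ = 0 := by
  refine testFn_induction_local (p := fun ψ => f ψ = 0) (map_zero f)
    (fun g₁ g₂ h₁ h₂ => by rw [map_add, h₁, h₂, add_zero]) φ fun x hx => ?_
  obtain ⟨s, hs, hso, hxs⟩ := (notMem_dsupport_iff x).1 (disjoint_left.1 h hx)
  exact ⟨s, hso, hxs, fun ψ _ hψ => hs ψ hψ⟩

end Localization

/-! ### Distributions as smooth functions on open sets. -/

section SmoothRepresentation

variable {E : Type} [NormedAddCommGroup E] [NormedSpace ℝ E] [MeasureSpace E]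

lemma IsSmoothFunOn.congr {f : Distr E} {U : Opens E} {g g' : E → ℂ} (h : IsSmoothFunOn f U g)
    (hg : EqOn g' g U) : IsSmoothFunOn f U g' := by
  refine ⟨h.1.congr hg, fun φ hφ => (h.2 φ hφ).trans (integral_congr_ae (.of_forall fun x => ?_))⟩
  by_cases hx : x ∈ tsupport φ
  · simp only [hg (hφ hx)]
  · simp only [image_eq_zero_of_notMem_tsupport hx, mul_zero]

lemma isSmoothFunOn_zero_of_isVanishingOn {f : Distr E} {U : Opens E}
    (h : IsVanishingOn f (U : Set E)) : IsSmoothFunOn f U 0 :=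
  ⟨contDiffOn_const, fun φ hφ => by simp [h φ hφ]⟩

lemma isClosed_singSupport (f : Distr E) : IsClosed (singSupport f) := by
  refine isOpen_compl_iff.1 (isOpen_iff_mem_nhds.2 fun x hx => ?_)
  obtain ⟨U, g, hxU, hg⟩ := not_not.1 hx
  filter_upwards [U.isOpen.mem_nhds hxU] with y hy
  exact not_not.2 ⟨U, g, hy, hg⟩

/-- The largest open set on which a distribution is a smooth function. -/
def regularSet (f : Distr E) : Opens E := ⟨(singSupport f)ᶜ, (isClosed_singSupport f).isOpen_compl⟩

lemma mem_regularSet {f : Distr E} {x : E} :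
    x ∈ regularSet f ↔ ∃ (U : Opens E) (g : E → ℂ), x ∈ U ∧ IsSmoothFunOn f U g :=
  not_not

lemma integrable_mul_testFn [BorelSpace E] [IsFiniteMeasureOnCompacts (volume : Measure E)]
    {U : Opens E} {g : E → ℂ} (hg : ContDiffOn ℝ ∞ g U) (φ : TestFn E) (hφ : tsupport φ ⊆ U) :
    Integrable fun x => g x * φ x :=
  (mulOn U g hg φ hφ).continuous.integrable_of_hasCompactSupport
    (mulOn U g hg φ hφ).hasCompactSupport

variable [FiniteDimensional ℝ E] [BorelSpace E]
  [IsFiniteMeasureOnCompacts (volume : Measure E)] [(volume : Measure E).IsOpenPosMeasure]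

/-- The fundamental lemma of the calculus of variations, for functions continuous on an open set. -/
lemma eqOn_of_forall_integral_mul_testFn_eq {U : Set E} (hU : IsOpen U) {g g' : E → ℂ}
    (hg : ContinuousOn g U) (hg' : ContinuousOn g' U)
    (h : ∀ φ : TestFn E, tsupport φ ⊆ U → ∫ x, g x * φ x = ∫ x, g' x * φ x) : EqOn g g' U := by
  have hint : ∀ f : E → ℂ, ContinuousOn f U → ∀ φ : TestFn E, tsupport φ ⊆ U →
      Integrable fun x => f x * φ x := by
    intro f hf φ hφ
    refine Continuous.integrable_of_hasCompactSupport ?_ φ.hasCompactSupport.mul_left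
    refine continuous_iff_continuousAt.2 fun x => ?_
    by_cases hx : x ∈ tsupport φ
    · exact (hf.continuousAt (hU.mem_nhds (hφ hx))).mul φ.continuous.continuousAt
    · refine continuousAt_const (y := (0 : ℂ)) |>.congr ?_
      filter_upwards [(isClosed_tsupport φ).isOpen_compl.mem_nhds hx] with y hy
      rw [image_eq_zero_of_notMem_tsupport hy, mul_zero]
  have key := IsOpen.ae_eq_zero_of_integral_contDiff_smul_eq_zero (μ := (volume : Measure E))
    (f := fun x => g x - g' x) hU ((hg.sub hg').locallyIntegrableOn hU.measurableSet) fun ψ hψ hc hs => by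
      let φ : TestFn E := ⟨fun x => (ψ x : ℂ), Complex.ofRealCLM.contDiff.comp hψ,
        hc.comp_left (g := Complex.ofReal) Complex.ofReal_zero, fun _ _ => trivial⟩
      have hφ : tsupport φ ⊆ U :=
        (closure_mono fun x hx h0 => hx (show (ψ x : ℂ) = 0 by
          rw [h0, Complex.ofReal_zero]) : tsupport φ ⊆ tsupport ψ).trans hs
      have h1 : ∀ x, ψ x • (g x - g' x) = g x * φ x - g' x * φ x := fun x => by
        rw [Complex.real_smul, mul_comm, sub_mul]
        rfl
      simp_rw [h1]
      rw [integral_sub (hint g hg φ hφ) (hint g' hg' φ hφ), h φ hφ, sub_self]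
  have hae : g =ᵐ[volume.restrict U] g' := by
    refine (ae_restrict_iff' hU.measurableSet).2 ?_
    filter_upwards [key] with x hx hxU using sub_eq_zero.1 (hx hxU)
  exact Measure.eqOn_open_of_ae_eq hae hU hg hg'

lemma IsSmoothFunOn.eqOn {f : Distr E} {U V : Opens E} {g g' : E → ℂ} (h : IsSmoothFunOn f U g)
    (h' : IsSmoothFunOn f V g') : EqOn g g' (U ∩ V) :=
  eqOn_of_forall_integral_mul_testFn_eq (U.isOpen.inter V.isOpen)
    (h.1.continuousOn.mono inter_subset_left) (h'.1.continuousOn.mono inter_subset_right)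
    fun φ hφ => by
      rw [← h.2 φ (hφ.trans inter_subset_left), ← h'.2 φ (hφ.trans inter_subset_right)]

/-- Off its singular support a distribution is a smooth function. -/
lemma exists_isSmoothFunOn_regularSet (f : Distr E) :
    ∃ g : E → ℂ, IsSmoothFunOn f (regularSet f) g := by
  choose! U g hxU hg using fun x (hx : x ∈ regularSet f) => mem_regularSet.1 hx
  have hmem : ∀ x ∈ regularSet f, ∀ y ∈ U x, y ∈ regularSet f := fun x hx y hy =>
    mem_regularSet.2 ⟨U x, g x, hy, hg x hx⟩
  -- Local representatives agree on overlaps, so the diagonal choice `y ↦ g y y` represents `f` near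
  -- every regular point.
  have heq : ∀ x ∈ regularSet f, IsSmoothFunOn f (U x) fun y => g y y := fun x hx =>
    (hg x hx).congr fun y hy =>
      (hg y (hmem x hx y hy)).eqOn (hg x hx) ⟨hxU y (hmem x hx y hy), hy⟩
  refine ⟨fun x => g x x, fun x hx => ?_, fun φ hφ => ?_⟩
  · exact ((heq x hx).1.contDiffAt ((U x).isOpen.mem_nhds (hxU x hx))).contDiffWithinAt
  -- Integrability is carried along because additivity of the integral needs it.
  · refine (testFn_induction_local (p := fun ψ => f ψ = ∫ x, g x x * ψ x ∧
      Integrable fun x => g x x * ψ x) ⟨by simp, by simp⟩ (fun ψ₁ ψ₂ h₁ h₂ => ?_) φ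
      fun x hx => ⟨U x, (U x).isOpen, hxU x (hφ hx), fun ψ _ hψ =>
        ⟨(heq x (hφ hx)).2 ψ hψ, integrable_mul_testFn (heq x (hφ hx)).1 ψ hψ⟩⟩).1
    simp only [testFn_add_apply, mul_add]
    exact ⟨by rw [map_add, h₁.1, h₂.1, integral_add h₁.2 h₂.2], h₁.2.add h₂.2⟩

end SmoothRepresentation

/-! ### Products of distributions with disjoint singular supports. -/

section Product

variable {E : Type} [NormedAddCommGroup E] [NormedSpace ℝ E] [MeasureSpace E]

lemma IsProduct.symm {f u P : Distr E} (h : IsProduct f u P) : IsProduct u f P := ⟨h.2, h.1⟩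

lemma IsProduct.isVanishingOn {f u P : Distr E} (h : IsProduct f u P) {s : Set E} (hs : IsOpen s)
    (hf : IsVanishingOn f s) : IsVanishingOn P s := fun φ hφ => by
  have h0 := isSmoothFunOn_zero_of_isVanishingOn (U := ⟨s, hs⟩) hf
  rw [h.1 ⟨s, hs⟩ 0 h0 φ hφ]
  convert map_zero u
  ext x
  exact zero_mul _

lemma IsProduct.dsupport_subset_left {f u P : Distr E} (h : IsProduct f u P) :
    dsupport P ⊆ dsupport f :=
  dsupport_subset_dsupport fun _ hs hf => h.isVanishingOn hs hf

lemma IsProduct.dsupport_subset {f u P : Distr E} (h : IsProduct f u P) :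
    dsupport P ⊆ dsupport f ∩ dsupport u :=
  subset_inter h.dsupport_subset_left h.symm.dsupport_subset_left

variable [FiniteDimensional ℝ E]

/-- Near each point at least one factor is a smooth function, and there the defining identities fix
the values of a product. -/
lemma IsProduct.unique {f u P Q : Distr E} (hP : IsProduct f u P) (hQ : IsProduct f u Q)
    (h : singSupport f ∩ singSupport u = ∅) : Q = P := by
  ext φ
  refine testFn_induction_local (p := fun ψ => Q ψ = P ψ) (by simp)
    (fun g₁ g₂ h₁ h₂ => by simp only [map_add, h₁, h₂]) φ fun x _ => ?_
  by_cases hx : x ∈ singSupport f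
  · obtain ⟨U, g, hxU, hg⟩ := mem_regularSet.1
      (show x ∈ regularSet u from fun hx' => h.subset ⟨hx, hx'⟩)
    exact ⟨U, U.isOpen, hxU, fun ψ _ hψ => by rw [hQ.2 U g hg ψ hψ, hP.2 U g hg ψ hψ]⟩
  · obtain ⟨U, g, hxU, hg⟩ := not_not.1 hx
    exact ⟨U, U.isOpen, hxU, fun ψ _ hψ => by rw [hQ.1 U g hg ψ hψ, hP.1 U g hg ψ hψ]⟩

variable [BorelSpace E]
  [IsFiniteMeasureOnCompacts (volume : Measure E)] [(volume : Measure E).IsOpenPosMeasure]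

/-- The glued candidate is `ρ a u + σ b f`. On `W` the functions `a` and `g` agree where both are
defined, while `∫ g b σ φ` can be read both as `f (b σ φ)` and as `u (σ g φ)`. So the two terms
recombine through `ρ + σ = 1`. -/
lemma glued_product_apply {f u : Distr E} {U V : Opens E} {a b ρ σ : E → ℂ}
    (ha : IsSmoothFunOn f U a) (hb : IsSmoothFunOn u V b) (hsum : ∀ x, ρ x + σ x = 1)
    (hρ : ContDiff ℝ ∞ ρ) (hσ : ContDiff ℝ ∞ σ) (hρU : tsupport ρ ⊆ U) (hσV : tsupport σ ⊆ V)
    (haρ : ContDiff ℝ ∞ fun x => a x * ρ x) (hbσ : ContDiff ℝ ∞ fun x => b x * σ x)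
    {W : Opens E} {g : E → ℂ} (hg : IsSmoothFunOn f W g) (φ : TestFn E) (hφ : tsupport φ ⊆ W) :
    u (mulCLM _ haρ φ) + f (mulCLM _ hbσ φ) = u (mulOn W g hg.1 φ hφ) := by
  have h1 : mulCLM _ haρ φ = mulCLM ρ hρ (mulOn W g hg.1 φ hφ) := by
    ext x
    simp only [mulCLM_apply, mulOn_apply]
    by_cases hx : x ∈ tsupport ρ
    · by_cases hx' : x ∈ tsupport φ
      · rw [ha.eqOn hg ⟨hρU hx, hφ hx'⟩]
        ring
      · simp [image_eq_zero_of_notMem_tsupport hx']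
    · simp [image_eq_zero_of_notMem_tsupport hx]
  have hsW : tsupport (mulCLM _ hbσ φ) ⊆ W := (tsupport_mulCLM_subset_right _ _ _).trans hφ
  have hsV : tsupport (mulCLM σ hσ (mulOn W g hg.1 φ hφ)) ⊆ V :=
    (tsupport_mulCLM_subset_left _ _ _).trans hσV
  have h2 : f (mulCLM _ hbσ φ) = u (mulCLM σ hσ (mulOn W g hg.1 φ hφ)) := by
    rw [hg.2 _ hsW, hb.2 _ hsV]
    congr 1 with x
    simp only [mulCLM_apply, mulOn_apply]
    ring
  rw [h1, h2, ← map_add]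
  congr 1
  ext x
  simp [← add_mul, hsum]

/-- Distributions with disjoint singular supports have a product. -/
theorem exists_isProduct {f u : Distr E} (h : singSupport f ∩ singSupport u = ∅) :
    ∃ P : Distr E, IsProduct f u P := by
  obtain ⟨a, ha⟩ := exists_isSmoothFunOn_regularSet f
  obtain ⟨b, hb⟩ := exists_isSmoothFunOn_regularSet u
  obtain ⟨ρ, σ, hρ, hσ, hsum, hρU, hσV⟩ := exists_smooth_partition (regularSet f).isOpen
    (regularSet u).isOpen (by
      change (singSupport f)ᶜ ∪ (singSupport u)ᶜ = univ
      rw [← compl_inter, h, compl_empty])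
  have haρ := contDiff_mul_of_tsupport_subset (regularSet f).isOpen ha.1 hρ hρU
  have hbσ := contDiff_mul_of_tsupport_subset (regularSet u).isOpen hb.1 hσ hσV
  refine ⟨PointwiseConvergenceCLM.precomp ℂ (mulCLM _ haρ) u +
    PointwiseConvergenceCLM.precomp ℂ (mulCLM _ hbσ) f, fun W g hg φ hφ => ?_,
    fun W g hg φ hφ => ?_⟩
  · exact glued_product_apply ha hb hsum hρ hσ hρU hσV haρ hbσ hg φ hφ
  · exact (add_comm _ _).trans (glued_product_apply hb ha
      (fun x => by rw [add_comm, hsum]) hσ hρ hσV hρU hbσ haρ hg φ hφ)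

end Product

/-! ### Projections along a compact factor. -/

section CompactProjection

variable {X Y : Type*} [TopologicalSpace X] [TopologicalSpace Y]

lemma isOpen_setOf_forall_mem_compact {C : Set X} (hC : IsCompact C) {S : Set (X × Y)}
    (hS : IsOpen S) : IsOpen {y | ∀ x ∈ C, (x, y) ∈ S} := by
  refine isOpen_iff_mem_nhds.2 fun y hy => ?_
  obtain ⟨N, M, -, hM, hCN, hyM, hNM⟩ := generalized_tube_lemma hC (isCompact_singleton (x := y))
    hS (by rintro ⟨a, b⟩ ⟨ha, rfl⟩; exact hy a ha)
  filter_upwards [hM.mem_nhds (hyM rfl)] with b hb a ha using hNM ⟨hCN ha, hb⟩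

lemma isClosed_setOf_exists_mem_compact {C : Set X} (hC : IsCompact C) {S : Set (X × Y)}
    (hS : IsClosed S) : IsClosed {y | ∃ x ∈ C, (x, y) ∈ S} := by
  convert! (isOpen_setOf_forall_mem_compact hC hS.isOpen_compl).isClosed_compl using 1
  ext y
  simp

end CompactProjection

/-! ### Support and singular support of `v ⊗ u`. -/

section TensorProduct

variable {E F : Type} [NormedAddCommGroup E] [NormedSpace ℝ E]
  [NormedAddCommGroup F] [NormedSpace ℝ F]

lemma tsupport_tensorTest_subset (φ : TestFn E) (ψ : TestFn F) :
    tsupport (tensorTest φ ψ) ⊆ tsupport φ ×ˢ tsupport ψ :=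
  closure_minimal (fun _ hp => ⟨subset_tsupport _ (left_ne_zero_of_mul hp),
    subset_tsupport _ (right_ne_zero_of_mul hp)⟩)
    ((isClosed_tsupport _).prod (isClosed_tsupport _))

variable [FiniteDimensional ℝ E] [MeasureSpace E] [BorelSpace E]
  [(volume : Measure E).IsAddHaarMeasure]

lemma tsupport_partialInt_subset (f : TestFn (E × F)) :
    tsupport (partialInt f) ⊆ Prod.snd '' tsupport f := by
  refine closure_minimal (fun y hy => ?_)
    (f.hasCompactSupport.isCompact.image continuous_snd).isClosed
  by_contra h
  refine hy (integral_eq_zero_of_ae (Filter.Eventually.of_forall fun x => ?_))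
  by_contra hx
  exact h ⟨(x, y), subset_tsupport _ hx, rfl⟩

lemma tensorDist_tensorTest (v θ : TestFn E) (u : Distr F) (φ : TestFn F) :
    tensorDist v u (tensorTest θ φ) = (∫ x, v x * θ x) * u φ := by
  rw [tensorDist_apply, ← smul_eq_mul, ← map_smul]
  congr 1
  ext y
  change ∫ x, v x * (θ x * φ y) = (∫ x, v x * θ x) * φ y
  simp_rw [← mul_assoc]
  exact integral_mul_const _ _

lemma dsupport_tensorDist_subset (v : TestFn E) (u : Distr F) :
    dsupport (tensorDist v u) ⊆ tsupport v ×ˢ univ := by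
  intro p hp
  refine ⟨by_contra fun h => ?_, trivial⟩
  refine (notMem_dsupport_iff p).2 ⟨(tsupport v)ᶜ ×ˢ univ, fun Φ hΦ => ?_,
    (isClosed_tsupport _).isOpen_compl.prod isOpen_univ, h, trivial⟩ hp
  rw [tensorDist_apply]
  convert map_zero u
  ext y
  refine integral_eq_zero_of_ae (.of_forall fun x => ?_)
  change v x * Φ (x, y) = 0
  by_cases hx : (x, y) ∈ tsupport Φ
  · rw [image_eq_zero_of_notMem_tsupport (hΦ hx).1, zero_mul]
  · rw [image_eq_zero_of_notMem_tsupport hx, mul_zero]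

/-- Otherwise the fundamental lemma would force `v = 0` on `N`. Such a `θ` recovers `u` from `v ⊗
u`, since then `⟨v ⊗ u, θ ⊗ φ⟩ = ⟨u, φ⟩`. -/
lemma exists_testFn_integral_mul_eq_one {v : TestFn E} {x : E} (hx : v x ≠ 0) {N : Set E}
    (hN : IsOpen N) (hxN : x ∈ N) : ∃ θ : TestFn E, tsupport θ ⊆ N ∧ ∫ x, v x * θ x = 1 := by
  obtain ⟨θ, hθ, h⟩ : ∃ θ : TestFn E, tsupport θ ⊆ N ∧ ∫ x, v x * θ x ≠ 0 := by
    by_contra! h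
    exact hx (eqOn_of_forall_integral_mul_testFn_eq hN v.continuous.continuousOn
      (continuousOn_const (c := (0 : ℂ))) (fun φ hφ => by simp [h φ hφ]) hxN)
  refine ⟨(∫ x, v x * θ x)⁻¹ • θ, (closure_mono (Function.support_const_smul_subset _ _)).trans hθ, ?_⟩
  change ∫ x, v x * ((∫ x, v x * θ x)⁻¹ * θ x) = 1
  simp_rw [fun z => mul_left_comm (v z) (∫ x, v x * θ x)⁻¹ (θ z)]
  rw [integral_const_mul, inv_mul_cancel₀ h]

lemma tsupport_prod_dsupport_subset (v : TestFn E) (u : Distr F) :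
    tsupport v ×ˢ dsupport u ⊆ dsupport (tensorDist v u) := by
  rintro ⟨x, y⟩ ⟨hx, hy⟩
  -- The support is closed, so it suffices to treat points with `v x ≠ 0`.
  refine closure_minimal (t := {x | (x, y) ∈ dsupport (tensorDist v u)}) (fun x hx => ?_)
    (isClosed_dsupport.preimage (by fun_prop : Continuous fun x : E => (x, y))) hx
  by_contra h
  obtain ⟨s, hs, hso, hxs⟩ := (notMem_dsupport_iff _).1 h
  obtain ⟨N, M, hN, hM, hxN, hyM, hNM⟩ := isOpen_prod_iff.1 hso x y hxs
  obtain ⟨θ, hθ, hθ1⟩ := exists_testFn_integral_mul_eq_one hx hN hxN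
  refine (notMem_dsupport_iff y).2 ⟨M, fun φ hφ => ?_, hM, hyM⟩ hy
  have := hs (tensorTest θ φ)
    (((tsupport_tensorTest_subset θ φ).trans (prod_mono hθ hφ)).trans hNM)
  rwa [tensorDist_tensorTest, hθ1, one_mul] at this

variable [FiniteDimensional ℝ F] [MeasureSpace F] [BorelSpace F]
  [(volume : Measure F).IsAddHaarMeasure]

lemma integral_testFn_prod (f : TestFn (E × F)) : ∫ p, f p = ∫ y, ∫ x, f (x, y) := by
  have : ProperSpace E := FiniteDimensional.proper_real E
  have : ProperSpace F := FiniteDimensional.proper_real F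
  rw [Measure.volume_eq_prod]
  refine integral_prod_symm _ ?_
  rw [← Measure.volume_eq_prod]
  exact f.continuous.integrable_of_hasCompactSupport f.hasCompactSupport

lemma integral_partialInt_mul (f : TestFn (E × F)) {g : F → ℂ} (hg : ContDiff ℝ ∞ g) :
    ∫ y, partialInt f y * g y = ∫ p, f p * g p.2 := by
  have h := integral_testFn_prod (mulCLM (fun p : E × F => g p.2) (hg.comp contDiff_snd) f)
  simp only [mulCLM_apply] at h
  simp_rw [mul_comm (f _), h, partialInt_apply, mul_comm _ (g _), ← integral_const_mul]

/-- Where `u` is a smooth function `g`, the tensor product `v ⊗ u` is the function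
`(x, y) ↦ v(x) g(y)`. -/
lemma IsSmoothFunOn.tensorDist {u : Distr F} {W : Opens F} {g : F → ℂ} (hg : IsSmoothFunOn u W g)
    (v : TestFn E) : IsSmoothFunOn (tensorDist v u) (W.comap ⟨Prod.snd, continuous_snd⟩)
      fun p : E × F => v p.1 * g p.2 := by
  have hc : ContDiffOn ℝ ∞ (fun p : E × F => v p.1 * g p.2)
      (W.comap ⟨Prod.snd, continuous_snd⟩ : Opens (E × F)) :=
    (v.contDiff.comp contDiff_fst).contDiffOn.mul (hg.1.comp contDiffOn_snd fun _ hp => hp)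
  refine ⟨hc, fun Φ hΦ => ?_⟩
  have h1 := integral_testFn_prod (mulOn _ _ hc Φ hΦ)
  simp only [mulOn_apply] at h1
  rw [h1, tensorDist_apply, hg.2]
  · congr 1 with y
    rw [partialInt_apply, ← integral_const_mul]
    congr 1 with x
    simp only [mulCLM_apply]
    ring
  · refine (tsupport_partialInt_subset _).trans ?_
    rintro _ ⟨p, hp, rfl⟩
    exact hΦ (tsupport_mulCLM_subset_right _ _ _ hp)

/-- With `∫ v θ = 1`, for `φ` supported near `y` one has `⟨u, φ⟩ = ⟨v ⊗ u, θ ⊗ φ⟩ = ∫ g (θ ⊗ φ)`, so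
by Fubini `u` is near `y` the partial integral of `g θ`. The cutoff `κ` makes `g (θ ⊗ κ)` a test
function on the whole product without changing it where `κ = 1`. -/
lemma mem_regularSet_of_tensorDist {v : TestFn E} {u : Distr F} {x : E} {y : F} (hx : v x ≠ 0)
    (h : (x, y) ∈ regularSet (tensorDist v u)) : y ∈ regularSet u := by
  obtain ⟨U, g, hU, hg⟩ := mem_regularSet.1 h
  obtain ⟨N, M, hN, hM, hxN, hyM, hNM⟩ := isOpen_prod_iff.1 U.isOpen x y hU
  obtain ⟨θ, hθ, hθ1⟩ := exists_testFn_integral_mul_eq_one hx hN hxN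
  obtain ⟨κ, hκ1, hκ⟩ := exists_testFn_one_nhds (isCompact_singleton (x := y)) hM
    (singleton_subset_iff.2 hyM)
  have hs : ∀ φ : TestFn F, tsupport φ ⊆ M → tsupport (tensorTest θ φ) ⊆ U := fun φ hφ =>
    ((tsupport_tensorTest_subset θ φ).trans (prod_mono hθ hφ)).trans hNM
  refine mem_regularSet.2 ⟨⟨interior {y | κ y = 1}, isOpen_interior⟩,
    partialInt (mulOn U g hg.1 (tensorTest θ κ) (hs κ hκ)),
    mem_interior_iff_mem_nhds.2 (by rwa [nhdsSet_singleton] at hκ1),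
    (TestFunction.contDiff _).contDiffOn, fun φ hφ => ?_⟩
  have h1 : ∀ z ∈ tsupport φ, κ z = 1 := fun z hz =>
    interior_subset (s := {y | κ y = 1}) (hφ hz)
  have hφM : tsupport φ ⊆ M := fun z hz =>
    hκ (subset_tsupport _ (by rw [Function.mem_support, h1 z hz]; exact one_ne_zero))
  rw [integral_partialInt_mul _ φ.contDiff]
  have h2 := hg.2 (tensorTest θ φ) (hs φ hφM)
  rw [tensorDist_tensorTest, hθ1, one_mul] at h2
  rw [h2]
  congr 1 with p
  simp only [mulOn_apply, tensorTest_apply]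
  by_cases hp : p.2 ∈ tsupport φ
  · rw [h1 _ hp]
    ring
  · simp [image_eq_zero_of_notMem_tsupport hp]

lemma tsupport_prod_singSupport_subset (v : TestFn E) (u : Distr F) :
    tsupport v ×ˢ singSupport u ⊆ singSupport (tensorDist v u) := by
  rintro ⟨x, y⟩ ⟨hx, hy⟩
  refine closure_minimal (t := {x | (x, y) ∈ singSupport (tensorDist v u)}) (fun x hx => ?_)
    ((isClosed_singSupport _).preimage (by fun_prop : Continuous fun x : E => (x, y))) hx
  by_contra h
  exact mem_regularSet_of_tensorDist hx h hy

end TensorProduct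

/-! ### Support of the transposed function. -/

section KernelSupport

variable {E F : Type} [NormedAddCommGroup E] [NormedSpace ℝ E]
  [NormedAddCommGroup F] [NormedSpace ℝ F] [FiniteDimensional ℝ E] [FiniteDimensional ℝ F]
  [MeasureSpace F] [BorelSpace F] [(volume : Measure F).IsAddHaarMeasure]

/-- If `K` applied to `v` in the first variable is the smooth function `w`, then `w` is supported
in the transposed relation `supp K` applied to `supp v`. -/
lemma tsupport_subset_of_kernel {K : Distr (E × F)} {v : TestFn E} {w : F → ℂ} (hw : ContDiff ℝ ∞ w)
    (hKw : ∀ φ : TestFn F, K (tensorTest v φ) = ∫ y, w y * φ y) :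
    tsupport w ⊆ {y | ∃ x ∈ tsupport v, (x, y) ∈ dsupport K} := by
  have hcl : IsClosed {y | ∃ x ∈ tsupport v, (x, y) ∈ dsupport K} :=
    isClosed_setOf_exists_mem_compact v.hasCompactSupport.isCompact isClosed_dsupport
  refine closure_minimal (fun y hy => by_contra fun h => hy ?_) hcl
  refine eqOn_of_forall_integral_mul_testFn_eq hcl.isOpen_compl hw.continuous.continuousOn
    (continuousOn_const (c := (0 : ℂ))) (fun φ hφ => ?_) h
  rw [← hKw, apply_eq_zero_of_disjoint_dsupport]
  · simp
  · refine disjoint_left.2 fun p hp hpK => ?_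
    obtain ⟨h1, h2⟩ := tsupport_tensorTest_subset v φ hp
    exact hφ h2 ⟨p.1, h1, hpK⟩

end KernelSupport

/-! ### Computation of the extended pairing. -/

section ExtendedPairing

variable {E F : Type} [NormedAddCommGroup E] [NormedSpace ℝ E]
  [NormedAddCommGroup F] [NormedSpace ℝ F] [FiniteDimensional ℝ E] [MeasureSpace E] [BorelSpace E]
  [(volume : Measure E).IsAddHaarMeasure] [FiniteDimensional ℝ F] [MeasureSpace F] [BorelSpace F]
  [(volume : Measure F).IsAddHaarMeasure]

/-- If `K` applied to `v` in the first variable is the smooth function `w`, then the extended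
pairing `⟨K, v ⊗ u⟩` is `⟨u, w⟩`. -/
theorem hasExtPairing_tensorDist {K : Distr (E × F)} {v : TestFn E} {u : Distr F} {w : F → ℂ}
    (hw : ContDiff ℝ ∞ w) (hKw : ∀ φ : TestFn F, K (tensorTest v φ) = ∫ y, w y * φ y) {c : ℂ}
    (hc : ∀ χ : TestFn F, (∀ᶠ y in 𝓝ˢ (tsupport w ∩ dsupport u), χ y = 1) → u (mulCLM w hw χ) = c)
    (hcomp : IsCompact (dsupport K ∩ dsupport (tensorDist v u)))
    (hsing : singSupport K ∩ singSupport (tensorDist v u) = ∅) :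
    HasExtPairing K (tensorDist v u) c := by
  obtain ⟨P, hP⟩ := exists_isProduct hsing
  have hPS := hP.dsupport_subset
  have hPv : dsupport P ⊆ tsupport v ×ˢ univ :=
    hP.symm.dsupport_subset_left.trans (dsupport_tensorDist_subset v u)
  refine ⟨P, hP, fun Q hQ => hP.unique hQ hsing, hcomp.of_isClosed_subset isClosed_dsupport hPS,
    fun Χ hΧ => ?_⟩
  set C : Set F := Prod.snd '' (dsupport K ∩ dsupport (tensorDist v u))
  obtain ⟨χ, hχ1, -⟩ := exists_testFn_one_nhds (hcomp.image continuous_snd : IsCompact C)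
    isOpen_univ (subset_univ _)
  have hwC : tsupport w ∩ dsupport u ⊆ C := by
    rintro y ⟨hy, hyu⟩
    obtain ⟨x, hx, hxy⟩ := tsupport_subset_of_kernel hw hKw hy
    exact ⟨(x, y), ⟨hxy, tsupport_prod_dsupport_subset v u ⟨hx, hyu⟩⟩, rfl⟩
  obtain ⟨k, hk⟩ := exists_isSmoothFunOn_regularSet K
  obtain ⟨g, hg⟩ := exists_isSmoothFunOn_regularSet u
  -- `χ₁` lives over points `y` with `supp v × {y}` in the regular set of `K`, `χ₂` where `u` is
  -- smooth. A point in neither set would give a common singular point of `K` and `v ⊗ u`.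
  obtain ⟨χ₁, χ₂, rfl, hχ₁, hχ₂⟩ := exists_testFn_split
    (isOpen_setOf_forall_mem_compact v.hasCompactSupport.isCompact (regularSet K).isOpen)
    (regularSet u).isOpen χ (fun y _ => by
      refine (em _).imp_right fun h y_sing => h fun x hx hxK => ?_
      exact hsing.subset ⟨hxK, tsupport_prod_singSupport_subset v u ⟨hx, y_sing⟩⟩)
  replace hχ₁ := hχ₁.trans inter_subset_right
  replace hχ₂ := hχ₂.trans inter_subset_right
  -- `θ` is chosen after `χ₁`: its support must be so close to `supp v` that `K` is smooth on all of
  -- `supp θ × supp χ₁`.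
  obtain ⟨N, M, hN, -, hvN, hχM, hNM⟩ := generalized_tube_lemma v.hasCompactSupport.isCompact
    χ₁.hasCompactSupport.isCompact (regularSet K).isOpen (fun p hp => hχ₁ hp.2 p.1 hp.1)
  obtain ⟨θ, hθ1, hθ⟩ := exists_testFn_one_nhds v.hasCompactSupport.isCompact hN hvN
  have hvθ : ∀ x, v x * θ x = v x := fun x => by
    by_cases hx : x ∈ tsupport v
    · rw [hθ1.self_of_nhdsSet x hx, mul_one]
    · rw [image_eq_zero_of_notMem_tsupport hx, zero_mul]
  -- Both test functions equal `1` near `supp P`, which lies over `supp v` in the first variable and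
  -- over `C` in the second.
  have hΧ' : P Χ = P (tensorTest θ (χ₁ + χ₂)) := by
    rw [← sub_eq_zero, ← map_sub]
    refine apply_eq_zero_of_disjoint_dsupport _ _ (disjoint_right.2 fun p hp => ?_)
    refine notMem_tsupport_iff_eventuallyEq.2 ?_
    have h2 := mem_nhdsSet_iff_forall.1 hθ1 p.1 (hPv hp).1
    have h3 := mem_nhdsSet_iff_forall.1 hχ1 p.2 ⟨p, hPS hp, rfl⟩
    filter_upwards [mem_nhdsSet_iff_forall.1 hΧ p hp, continuous_fst.continuousAt.preimage_mem_nhds h2,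
      continuous_snd.continuousAt.preimage_mem_nhds h3] with q hq1 hq2 hq3
    have e1 : Χ q = 1 := hq1
    have e2 : θ q.1 = 1 := hq2
    have e3 : (χ₁ + χ₂) q.2 = 1 := hq3
    change Χ q - θ q.1 * (χ₁ + χ₂) q.2 = 0
    rw [e1, e2, e3, mul_one, sub_self]
  have hadd : tensorTest θ (χ₁ + χ₂) = tensorTest θ χ₁ + tensorTest θ χ₂ := by
    ext p
    exact mul_add _ _ _
  rw [hΧ', hadd, map_add, ← hc _ (hχ1.filter_mono (nhdsSet_mono hwC)), map_add, map_add]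
  congr 1
  · have hs : tsupport (tensorTest θ χ₁) ⊆ regularSet K :=
      ((tsupport_tensorTest_subset θ χ₁).trans (prod_mono hθ hχM)).trans hNM
    rw [hP.1 _ k hk _ hs, tensorDist_apply]
    congr 1
    ext y
    -- `K` is the function `k` here, and `∫ v(x) k(x, y) θ(x) χ₁(y) dx = w(y) χ₁(y)` is checked by
    -- integrating against `φ`, using the kernel identity for `χ₁ φ`.
    refine eqOn_of_forall_integral_mul_testFn_eq isOpen_univ
      (TestFunction.continuous _).continuousOn (TestFunction.continuous _).continuousOn
      (fun φ _ => ?_) (mem_univ y)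
    have h1 := hKw (mulCLM χ₁ χ₁.contDiff φ)
    rw [hk.2] at h1
    · rw [integral_partialInt_mul _ φ.contDiff]
      calc _ = _ := ?_
        _ = _ := h1
        _ = _ := ?_
      · congr 1 with p
        simp only [mulCLM_apply, mulOn_apply, tensorTest_apply]
        linear_combination (k p * χ₁ p.2 * φ p.2) * hvθ p.1
      · congr 1 with y
        simp only [mulCLM_apply]
        ring
    · intro p hp
      obtain ⟨h2, h3⟩ := tsupport_tensorTest_subset v _ hp
      exact hχ₁ (tsupport_mulCLM_subset_left _ _ _ h3) p.1 h2
  · have hs : tsupport (tensorTest θ χ₂) ⊆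
        ((regularSet u).comap ⟨Prod.snd, continuous_snd⟩ : Opens (E × F)) :=
      fun p hp => hχ₂ (tsupport_tensorTest_subset θ χ₂ hp).2
    -- Here `v ⊗ u` is the function `v ⊗ g`, so `P (θ ⊗ χ₂) = K (v ⊗ g χ₂) = ∫ w g χ₂ = u (w χ₂)`.
    have h1 := hKw (mulOn (regularSet u) g hg.1 χ₂ hχ₂)
    rw [hP.2 _ _ (hg.tensorDist v) _ hs, hg.2 _ ((tsupport_mulCLM_subset_right _ _ _).trans hχ₂)]
    calc _ = _ := ?_
      _ = _ := h1
      _ = _ := ?_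
    · congr 1
      ext p
      simp only [mulOn_apply, tensorTest_apply]
      linear_combination (g p.2 * χ₂ p.2) * hvθ p.1
    · congr 1 with y
      simp only [mulCLM_apply, mulOn_apply]
      ring

end ExtendedPairing

/-! ### Continuous functionals on weak duals. -/

section WeakDual

/-- A functional on a dual space that is continuous for the topology of pointwise convergence is
the evaluation at a point. -/
lemma exists_eq_eval_of_pointwise {V : Type*} [AddCommGroup V] [Module ℂ V] [TopologicalSpace V]
    (L : (V →Lₚₜ[ℂ] ℂ) →L[ℂ] ℂ) : ∃ w : V, ∀ u : V →Lₚₜ[ℂ] ℂ, L u = u w := by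
  let ev : V →ₗ[ℂ] (V →Lₚₜ[ℂ] ℂ) →ₗ[ℂ] ℂ := (PointwiseConvergenceCLM.coeLM ℂ V ℂ).flip
  -- The pointwise topology is induced by the evaluations, so a continuous functional is a finite
  -- linear combination of them; by linearity of `ev` this is a single evaluation.
  have hmem : (L : (V →Lₚₜ[ℂ] ℂ) →ₗ[ℂ] ℂ) ∈ Submodule.span ℂ (range ev) := by
    refine (LinearMap.mem_span_iff_continuous _).2 ?_
    have ht : (inferInstance : TopologicalSpace (V →Lₚₜ[ℂ] ℂ)) =
        ⨅ v, induced (ev v) inferInstance := by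
      rw [(PointwiseConvergenceCLM.isEmbedding_coeFn (RingHom.id ℂ) V ℂ).eq_induced, induced_to_pi]
      rfl
    rw [← ht]
    exact L.continuous
  rw [← LinearMap.coe_range, Submodule.span_eq] at hmem
  obtain ⟨w, hw⟩ := hmem
  exact ⟨w, fun u => (LinearMap.congr_fun hw u).symm⟩

end WeakDual

/-! ### Approximation of Schwartz functions by cutoffs. -/

section SchwartzCutoff

variable {E : Type} [NormedAddCommGroup E] [NormedSpace ℝ E]

lemma exists_norm_iteratedFDeriv_testFn_sub_one_le (χ : TestFn E) (i : ℕ) :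
    ∃ B : ℝ, 0 ≤ B ∧ ∀ x, ‖iteratedFDeriv ℝ i (fun y => χ y - 1) x‖ ≤ B := by
  refine ⟨SchwartzMap.seminorm ℂ 0 i (toSchwartz χ) + 1, by positivity, fun x => ?_⟩
  have h1 : iteratedFDeriv ℝ i (fun y => χ y - 1) x
      = iteratedFDeriv ℝ i χ x - iteratedFDeriv ℝ i (fun _ => (1 : ℂ)) x :=
    iteratedFDeriv_sub_apply (χ.contDiff.of_le (by exact_mod_cast le_top)).contDiffAt
      contDiff_const.contDiffAt
  rw [h1]
  refine (norm_sub_le _ _).trans (add_le_add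
    ((toSchwartz χ).norm_iteratedFDeriv_le_seminorm ℂ i x) ?_)
  rcases eq_or_ne i 0 with rfl | hi
  · rw [norm_iteratedFDeriv_zero, norm_one]
  · rw [iteratedFDeriv_const_of_ne hi]
    simp

/-- The dilation `x ↦ χ (t x)` of a test function. -/
lemma exists_testFn_dilation (χ : TestFn E) {t : ℝ} (ht : t ≠ 0) :
    ∃ χt : TestFn E, ∀ x, χt x = χ (t • x) :=
  ⟨⟨fun x => χ (t • x), χ.contDiff.comp (contDiff_const_smul t),
    χ.hasCompactSupport.comp_smul ht, fun _ _ => trivial⟩, fun _ => rfl⟩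

/-- The difference is `(χ(t x) - 1) g(x)`, which vanishes for `‖x‖ < r / t`. Elsewhere `1 ≤ ‖x‖ t /
r`, so one more power of `‖x‖`, absorbed by the decay of `g`, buys the factor `t`. Derivatives of
the dilated cutoff stay bounded because `t ≤ 1`. -/
lemma seminorm_cutoff_sub_le (χ : TestFn E) {r : ℝ} (hr : 0 < r)
    (hχ : ∀ x ∈ Metric.ball (0 : E) r, χ x = 1) (g : 𝓢(E, ℂ)) (k m : ℕ) :
    ∃ C : ℝ, ∀ t : ℝ, 0 < t → t ≤ 1 → ∀ φ : TestFn E, (∀ x, φ x = g x * χ (t • x)) →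
      SchwartzMap.seminorm ℂ k m (toSchwartz φ - g) ≤ C * t := by
  choose B hB0 hB using exists_norm_iteratedFDeriv_testFn_sub_one_le χ
  set S : ℝ := ∑ i ∈ Finset.range (m + 1), (m.choose i : ℝ) * B i *
    SchwartzMap.seminorm ℂ (k + 1) (m - i) g with hS
  have hS0 : 0 ≤ S := Finset.sum_nonneg fun i _ => by have := hB0 i; positivity
  refine ⟨S / r, fun t ht ht1 φ hφ => SchwartzMap.seminorm_le_bound ℂ k m _ (by positivity)
    fun x => ?_⟩
  set h : E → ℂ := fun y => χ y - 1 with hh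
  have hhc : ContDiff ℝ ∞ h := χ.contDiff.sub contDiff_const
  set T : E →L[ℝ] E := t • ContinuousLinearMap.id ℝ E with hT
  have hcoe : ⇑(toSchwartz φ - g) = fun y => (h ∘ T) y * g y := by
    ext y
    change φ y - g y = (χ (t • y) - 1) * g y
    rw [hφ]
    ring
  rw [hcoe]
  by_cases hx : ‖t • x‖ < r
  · have h0 : (fun y => (h ∘ T) y * g y) =ᶠ[𝓝 x] fun _ => 0 := by
      have : ∀ᶠ y in 𝓝 x, ‖t • y‖ < r :=
        (continuous_const_smul t).norm.continuousAt.eventually_lt continuousAt_const hx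
      filter_upwards [this] with y hy
      change (χ (t • y) - 1) * g y = 0
      rw [hχ _ (by simpa using hy), sub_self, zero_mul]
    rw [(h0.iteratedFDeriv ℝ m).self_of_nhds, iteratedFDeriv_fun_zero]
    simp only [Pi.zero_apply, norm_zero, mul_zero]
    positivity
  · have hx' : 1 ≤ ‖x‖ * t / r := by
      rw [norm_smul, Real.norm_of_nonneg ht.le, not_lt] at hx
      rw [one_le_div hr]
      linarith
    have hTn : ‖T‖ ≤ 1 := by
      refine ContinuousLinearMap.opNorm_le_bound _ zero_le_one fun y => ?_
      change ‖t • y‖ ≤ _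
      rw [norm_smul, Real.norm_of_nonneg ht.le]
      gcongr
    have hderiv : ∀ i, ‖iteratedFDeriv ℝ i (h ∘ T) x‖ ≤ B i := fun i => by
      rw [T.iteratedFDeriv_comp_right hhc x (by exact_mod_cast le_top)]
      refine (ContinuousMultilinearMap.norm_compContinuousLinearMap_le _ _).trans ?_
      refine (mul_le_of_le_one_right (norm_nonneg _) ?_).trans (hB i _)
      exact Finset.prod_le_one (fun _ _ => norm_nonneg _) fun _ _ => hTn
    have hleib := norm_iteratedFDeriv_mul_le (hhc.comp T.contDiff) g.smooth' x (n := m)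
      (by exact_mod_cast le_top)
    calc ‖x‖ ^ k * ‖iteratedFDeriv ℝ m (fun y => (h ∘ T) y * g y) x‖
        ≤ (‖x‖ * t / r) * (‖x‖ ^ k * ‖iteratedFDeriv ℝ m (fun y => (h ∘ T) y * g y) x‖) :=
          le_mul_of_one_le_left (by positivity) hx'
      _ = (t / r) * (‖x‖ ^ (k + 1) * ‖iteratedFDeriv ℝ m (fun y => (h ∘ T) y * g y) x‖) := by ring
      _ ≤ (t / r) * S := ?_
      _ = S / r * t := by ring
    gcongr
    refine (mul_le_mul_of_nonneg_left hleib (by positivity)).trans ?_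
    rw [Finset.mul_sum]
    refine Finset.sum_le_sum fun i _ => ?_
    calc ‖x‖ ^ (k + 1) * ((m.choose i : ℝ) * ‖iteratedFDeriv ℝ i (h ∘ T) x‖ *
          ‖iteratedFDeriv ℝ (m - i) g x‖)
        = (m.choose i : ℝ) * ‖iteratedFDeriv ℝ i (h ∘ T) x‖ *
          (‖x‖ ^ (k + 1) * ‖iteratedFDeriv ℝ (m - i) g x‖) := by ring
      _ ≤ _ := by
        gcongr
        · exact mul_nonneg (by positivity) (hB0 i)
        · exact hderiv i
        · exact g.le_seminorm ℂ (k + 1) (m - i) x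

/-- A Schwartz function is a limit of test functions supported in its support. -/
lemma exists_tendsto_toSchwartz [FiniteDimensional ℝ E] (g : 𝓢(E, ℂ)) :
    ∃ φ : ℕ → TestFn E, (∀ j, tsupport (φ j) ⊆ tsupport g) ∧
      Filter.Tendsto (fun j => toSchwartz (φ j)) Filter.atTop (𝓝 g) := by
  obtain ⟨χ, hχ, -⟩ := exists_testFn_one_nhds (isCompact_singleton (x := (0 : E))) isOpen_univ
    (subset_univ _)
  rw [nhdsSet_singleton] at hχ
  obtain ⟨r, hr, hχr⟩ := Metric.eventually_nhds_iff_ball.1 hχ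
  have ht : ∀ j : ℕ, (0 : ℝ) < 1 / (j + 1) := fun j => Nat.one_div_pos_of_nat
  choose χt hχt using fun j => exists_testFn_dilation χ (ht j).ne'
  have hg : ContDiff ℝ ∞ g := g.smooth'
  refine ⟨fun j => mulCLM g hg (χt j), fun j => tsupport_mulCLM_subset_left _ _ _, ?_⟩
  refine ((schwartz_withSeminorms ℂ E ℂ).tendsto_nhds _ g).2 fun ⟨k, m⟩ ε hε => ?_
  obtain ⟨C, hC⟩ := seminorm_cutoff_sub_le χ hr hχr g k m
  have hlim : Filter.Tendsto (fun j : ℕ => C * (1 / ((j : ℝ) + 1))) Filter.atTop (𝓝 0) := by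
    simpa using (tendsto_one_div_add_atTop_nhds_zero_nat (𝕜 := ℝ)).const_mul C
  filter_upwards [hlim.eventually_lt_const hε] with j hj
  refine (hC _ (ht j) ?_ _ fun x => ?_).trans_lt hj
  · rw [div_le_one (by positivity)]
    linarith [(Nat.cast_nonneg j : (0 : ℝ) ≤ j)]
  · rw [mulCLM_apply, hχt]

/-- A tempered distribution vanishes on Schwartz functions supported off its support. -/
lemma tempered_apply_eq_zero_of_disjoint [FiniteDimensional ℝ E] (u : 𝓢'(E, ℂ)) (g : 𝓢(E, ℂ))
    (h : Disjoint (tsupport g) (dsupport (toDistr u))) : u g = 0 := by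
  obtain ⟨φ, hφ, hlim⟩ := exists_tendsto_toSchwartz g
  refine tendsto_nhds_unique (((map_continuous u).tendsto g).comp hlim) ?_
  refine tendsto_const_nhds.congr fun j => ?_
  rw [Function.comp_apply, ← toDistr_apply]
  exact (apply_eq_zero_of_disjoint_dsupport _ _ (h.mono_left (hφ j))).symm

end SchwartzCutoff

/-! ### Transposes of operators and the conclusions. -/

section Kernels

/-- With `S = supp u` this justifies replacing `⟨u, w χ⟩` by `⟨u, w⟩`: `χ` only needs to be `1` near
`supp w ∩ supp u`. -/
lemma disjoint_tsupport_mul_sub {X : Type*} [TopologicalSpace X]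
    {w χ : X → ℂ} {S : Set X}
    (hχ : ∀ᶠ y in 𝓝ˢ (tsupport w ∩ S), χ y = 1) :
    Disjoint (tsupport fun y => w y * χ y - w y) S := by
  refine disjoint_left.2 fun y hy hyS => ?_
  have hyw : y ∈ tsupport w := closure_mono (Function.support_subset_iff'.2 fun z hz => by
    simp [Function.notMem_support.1 hz]) hy
  refine (notMem_tsupport_iff_eventuallyEq.2 ?_) hy
  filter_upwards [mem_nhdsSet_iff_forall.1 hχ y ⟨hyw, hyS⟩] with z hz
  have : χ z = 1 := hz
  simp [this]

lemma isClosed_relComp {X Y : Type} [TopologicalSpace X] [TopologicalSpace Y] {S : Set (X × Y)}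
    {T : Set Y} (hS : IsClosed S) (hT : IsCompact T) : IsClosed (relComp S T) :=
  isClosed_setOf_exists_mem_compact hT (hS.preimage continuous_swap)

variable {E : Type} [NormedAddCommGroup E] [NormedSpace ℝ E] [FiniteDimensional ℝ E]
  [MeasureSpace E] [BorelSpace E] [(volume : Measure E).IsAddHaarMeasure]

/-- The transpose of an operator on distributions, applied to a test function. -/
lemma IsKernel.exists_transpose {A : Distr E →L[ℂ] Distr E} {K : Distr (E × E)} (h : IsKernel A K)
    (v : TestFn E) : ∃ w : TestFn E, (∀ u, A u v = u w) ∧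
      ∀ φ : TestFn E, K (tensorTest v φ) = ∫ y, w y * φ y := by
  obtain ⟨w, hw⟩ := exists_eq_eval_of_pointwise
    ((PointwiseConvergenceCLM.evalCLM (RingHom.id ℂ) ℂ v).comp A)
  refine ⟨w, hw, fun φ => ?_⟩
  rw [← h φ v, ← ofTest_apply]
  -- Evaluating the functional at the distribution `φ` identifies `w` with `K` applied to `v`.
  exact hw (ofTest φ)

/-- The transpose of an operator on tempered distributions, applied to a test function. -/
lemma IsTemperedKernel.exists_transpose {A : 𝓢'(E, ℂ) →L[ℂ] 𝓢'(E, ℂ)} {K : 𝓢'(E × E, ℂ)}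
    (h : IsTemperedKernel A K) (v : TestFn E) :
    ∃ w : 𝓢(E, ℂ), (∀ u, A u (toSchwartz v) = u w) ∧
      ∀ φ : TestFn E, toDistr K (tensorTest v φ) = ∫ y, w y * φ y := by
  obtain ⟨w, hw⟩ := exists_eq_eval_of_pointwise
    ((PointwiseConvergenceCLM.evalCLM (RingHom.id ℂ) ℂ (toSchwartz v)).comp A)
  refine ⟨w, hw, fun φ => ?_⟩
  rw [toDistr_apply, ← h φ v]
  exact (hw _).trans
    (SchwartzMap.toTemperedDistributionCLM_apply_apply volume (toSchwartz φ) w)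

lemma disjoint_tsupport_dsupport {K : Distr (E × E)} {u : Distr E} {v : TestFn E} {w : E → ℂ}
    (hw : ContDiff ℝ ∞ w) (hKw : ∀ φ : TestFn E, K (tensorTest v φ) = ∫ y, w y * φ y)
    (hv : tsupport v ⊆ (closure (relComp (dsupport K) (dsupport u)))ᶜ) :
    Disjoint (tsupport w) (dsupport u) := by
  refine disjoint_left.2 fun y hy hyu => ?_
  obtain ⟨x, hx, hxy⟩ := tsupport_subset_of_kernel hw hKw hy
  exact hv hx (subset_closure ⟨y, hyu, hxy⟩)

theorem IsKernel.hasExtPairing {A : Distr E →L[ℂ] Distr E} {K : Distr (E × E)} (h : IsKernel A K)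
    (u : Distr E) (v : TestFn E) (hcomp : IsCompact (dsupport K ∩ dsupport (tensorDist v u)))
    (hsing : singSupport K ∩ singSupport (tensorDist v u) = ∅) :
    HasExtPairing K (tensorDist v u) (A u v) := by
  obtain ⟨w, hw, hKw⟩ := h.exists_transpose v
  refine hasExtPairing_tensorDist w.contDiff hKw (fun χ hχ => ?_) hcomp hsing
  rw [hw, ← sub_eq_zero, ← map_sub]
  exact apply_eq_zero_of_disjoint_dsupport _ _ (disjoint_tsupport_mul_sub hχ)

theorem IsKernel.dsupport_subset {A : Distr E →L[ℂ] Distr E} {K : Distr (E × E)}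
    (h : IsKernel A K) (u : Distr E) :
    dsupport (A u) ⊆ closure (relComp (dsupport K) (dsupport u)) := by
  refine fun x hx => by_contra fun hx' => ?_
  refine (notMem_dsupport_iff x).2 ⟨_, fun v hv => ?_, isClosed_closure.isOpen_compl, hx'⟩ hx
  obtain ⟨w, hw, hKw⟩ := h.exists_transpose v
  rw [hw]
  exact apply_eq_zero_of_disjoint_dsupport _ _ (disjoint_tsupport_dsupport w.contDiff hKw hv)

theorem IsTemperedKernel.hasExtPairing {A : 𝓢'(E, ℂ) →L[ℂ] 𝓢'(E, ℂ)} {K : 𝓢'(E × E, ℂ)}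
    (h : IsTemperedKernel A K) (u : 𝓢'(E, ℂ)) (v : TestFn E)
    (hcomp : IsCompact (dsupport (toDistr K) ∩ dsupport (tensorDist v (toDistr u))))
    (hsing : singSupport (toDistr K) ∩ singSupport (tensorDist v (toDistr u)) = ∅) :
    HasExtPairing (toDistr K) (tensorDist v (toDistr u)) (toDistr (A u) v) := by
  obtain ⟨w, hw, hKw⟩ := h.exists_transpose v
  have hws : ContDiff ℝ ∞ w := w.smooth'
  refine hasExtPairing_tensorDist hws hKw (fun χ hχ => ?_) hcomp hsing
  rw [toDistr_apply, toDistr_apply, hw, ← sub_eq_zero, ← map_sub]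
  exact tempered_apply_eq_zero_of_disjoint _ _ (disjoint_tsupport_mul_sub hχ)

theorem IsTemperedKernel.dsupport_subset {A : 𝓢'(E, ℂ) →L[ℂ] 𝓢'(E, ℂ)} {K : 𝓢'(E × E, ℂ)}
    (h : IsTemperedKernel A K) (u : 𝓢'(E, ℂ)) :
    dsupport (toDistr (A u)) ⊆ closure (relComp (dsupport (toDistr K)) (dsupport (toDistr u))) := by
  refine fun x hx => by_contra fun hx' => ?_
  refine (notMem_dsupport_iff x).2 ⟨_, fun v hv => ?_, isClosed_closure.isOpen_compl, hx'⟩ hx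
  obtain ⟨w, hw, hKw⟩ := h.exists_transpose v
  have hws : ContDiff ℝ ∞ w := w.smooth'
  rw [toDistr_apply, hw]
  exact tempered_apply_eq_zero_of_disjoint _ _ (disjoint_tsupport_dsupport hws hKw hv)

end Kernels

end DistKernel

end

theorem mainTheorem8 (n : ℕ) :
    (∀ (A : 𝓢'(Rn n, ℂ) →L[ℂ] 𝓢'(Rn n, ℂ)) (K : 𝓢'(Rn n × Rn n, ℂ)), IsTemperedKernel A K →
      (∀ (u : 𝓢'(Rn n, ℂ)) (v : TestFn (Rn n)),
        IsCompact (dsupport (toDistr K) ∩ dsupport (tensorDist v (toDistr u))) →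
        singSupport (toDistr K) ∩ singSupport (tensorDist v (toDistr u)) = ∅ →
        HasExtPairing (toDistr K) (tensorDist v (toDistr u)) (toDistr (A u) v)) ∧
      (∀ u : 𝓢'(Rn n, ℂ),
        dsupport (toDistr (A u)) ⊆
          closure (relComp (dsupport (toDistr K)) (dsupport (toDistr u))) ∧
        (IsCompact (dsupport (toDistr u)) →
          IsClosed (relComp (dsupport (toDistr K)) (dsupport (toDistr u)))))) ∧
    (∀ (A : Distr (Rn n) →L[ℂ] Distr (Rn n)) (K : Distr (Rn n × Rn n)), IsKernel A K →
      (∀ (u : Distr (Rn n)) (v : TestFn (Rn n)),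
        IsCompact (dsupport K ∩ dsupport (tensorDist v u)) →
        singSupport K ∩ singSupport (tensorDist v u) = ∅ →
        HasExtPairing K (tensorDist v u) (A u v)) ∧
      (∀ u : Distr (Rn n),
        dsupport (A u) ⊆ closure (relComp (dsupport K) (dsupport u)) ∧
        (IsCompact (dsupport u) → IsClosed (relComp (dsupport K) (dsupport u))))) := by
  exact ⟨fun _ _ h => ⟨h.hasExtPairing, fun u => ⟨h.dsupport_subset u,
      isClosed_relComp isClosed_dsupport⟩⟩,
    fun _ _ h => ⟨h.hasExtPairing, fun u => ⟨h.dsupport_subset u,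
      isClosed_relComp isClosed_dsupport⟩⟩⟩
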